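/- Let $(\Omega,\mathcal F,\mathbb P)$ be a complete probability space and let $X$ be a Polish space with Borel $\sigma$-algebra $\mathcal B(X)$. Let $f:\Omega\times X\to\mathbb R$ be a measurable random function, i.e. $f$ is measurable with respect to the product $\sigma$-algebra $\mathcal F\otimes\mathcal B(X)$. Let $C$ be a mapping that assigns to each $\omega\in\Omega$ a non-empty closed subset $C(\omega)$ of $X$ and that is measurable, i.e. $\{\omega\in\Omega : C(\omega)\cap B\neq\emptyset\}\in\mathcal F$ for every open set $B\subseteq X$. Then the optimal value $$\eta(\omega)=\inf_{x\in C(\omega)} f(\omega,x),\qquad \omega\in\Omega,$$ is a measurable function from $(\Omega,\mathcal F)$ to $[-\infty,\infty)$, regarded as a subset of the extended real line with its Borel $\sigma$-algebra. In particular, if the infimum is finite for every $\omega\in\Omega$, then $\eta:\Omega\to\mathbb R$ is a real-valued random variable. -/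

import Mathlib

open MeasureTheory

/-- A set-valued mapping `C` from a measurable space `Ω` to subsets of a topological space `X` is
measurable if `C⁻¹(B) = {ω | C ω ∩ B ≠ ∅}` is a measurable set for each open subset `B` of `X`. -/
def MeasurableSetValued {Ω X : Type*} [MeasurableSpace Ω] [TopologicalSpace X]
    (C : Ω → Set X) : Prop :=
  ∀ B : Set X, IsOpen B → MeasurableSet {ω | (C ω ∩ B).Nonempty}

/-- The optimal value `ω ↦ inf_{x ∈ C ω} f (ω, x)`, as an extended real number
(it is `-∞` exactly when `f (ω, ·)` is unbounded below on the nonempty set `C ω`). -/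
noncomputable def optimalValue {Ω X : Type*} (f : Ω × X → ℝ) (C : Ω → Set X) (ω : Ω) : EReal :=
  ⨅ x ∈ C ω, (f (ω, x) : EReal)

/-! The set where the optimal value is below `a` is the projection to `Ω` of the graph of `C`
intersected with `{f < a}`, so everything rests on measurable projection. A measurable set in `Ω ×
X` involves only countably many events of `Ω`, hence is pulled back from Cantor space times `X`.
There projections of Borel sets are analytic, so universally measurable by approximation with
compact sets, and completeness of `P` absorbs the null sets. -/

/-- Boxes in Baire space are compact. -/
theorem isCompact_setOf_forall_le (k : ℕ → ℕ) : IsCompact {x : ℕ → ℕ | ∀ i, x i ≤ k i} := by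
  convert isCompact_univ_pi fun i => (Set.finite_Iic (k i)).isCompact using 1
  ext x
  simp [Pi.le_def]

/-- If `V` is open in Baire space and contains the compact box `{x | ∀ i, x i ≤ k i}`, then `V`
already contains a cylinder that constrains only finitely many coordinates. -/
theorem exists_cylinder_subset_of_box_subset {V : Set (ℕ → ℕ)} (hV : IsOpen V) (k : ℕ → ℕ)
    (hk : {x | ∀ i, x i ≤ k i} ⊆ V) : ∃ n, {x : ℕ → ℕ | ∀ i < n, x i ≤ k i} ⊆ V := by
  by_contra! h
  simp only [Set.not_subset] at h
  choose x hx hxV using h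
  -- Truncating `x n` into the box leaves its first `n` coordinates unchanged, so limits agree.
  obtain ⟨y, hy, φ, hφ, hlim⟩ := (isCompact_setOf_forall_le k).tendsto_subseq
    (x := fun n i => min (x n i) (k i)) (fun n i => min_le_right _ _)
  have hlim' : Filter.Tendsto (x ∘ φ) Filter.atTop (nhds y) := by
    rw [tendsto_pi_nhds] at hlim ⊢
    intro i
    refine (hlim i).congr' ?_
    filter_upwards [Filter.eventually_gt_atTop i] with n hn
    exact min_eq_left (hx (φ n) i (hn.trans_le (hφ.id_le n)))
  obtain ⟨n, hn⟩ := (hlim'.eventually (hV.mem_nhds (hk hy))).exists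
  exact hxV _ hn

/-- Inner approximation of a continuous image of Baire space by images of compact boxes. -/
theorem exists_box_image_measure_ge {Y : Type*} [TopologicalSpace Y] [MeasurableSpace Y]
    (μ : Measure Y) [μ.OuterRegular] {g : (ℕ → ℕ) → Y} (hg : Continuous g)
    {c : ENNReal} (hc : c < μ (Set.range g)) :
    ∃ k : ℕ → ℕ, c ≤ μ (g '' {x | ∀ i, x i ≤ k i}) := by
  -- Continuity from below: a large enough bound on coordinate `n` keeps the measure above `c`.
  have step (n : ℕ) (k : ℕ → ℕ) (h : c < μ (g '' {x | ∀ i < n, x i ≤ k i})) :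
      ∃ m, c < μ (g '' {x | ∀ i < n + 1, x i ≤ Function.update k n m i}) := by
    have hmono : Monotone
        fun m => g '' {x : ℕ → ℕ | ∀ i < n + 1, x i ≤ Function.update k n m i} := by
      intro m m' hm
      refine Set.image_mono fun x hx i hi => (hx i hi).trans ?_
      rcases eq_or_ne i n with rfl | hin
      · simpa
      · simp [hin]
    have hU : g '' {x | ∀ i < n, x i ≤ k i} ⊆
        ⋃ m, g '' {x : ℕ → ℕ | ∀ i < n + 1, x i ≤ Function.update k n m i} := by
      rw [← Set.image_iUnion]
      refine Set.image_mono fun x hx => Set.mem_iUnion.2 ⟨x n, fun i hi => ?_⟩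
      rcases eq_or_ne i n with rfl | hin
      · simp
      · simpa [hin] using hx i (by omega)
    have := h.trans_le (measure_mono hU)
    rwa [hmono.measure_iUnion, lt_iSup_iff] at this
  choose m hm using step
  let S (n : ℕ) := {k : ℕ → ℕ // c < μ (g '' {x | ∀ i < n, x i ≤ k i})}
  let K : ∀ n, S n := fun n => Nat.rec (motive := S) ⟨0, by simpa using hc⟩
    (fun n k => ⟨Function.update k.1 n (m n k.1 k.2), hm n k.1 k.2⟩) n
  have hK (n i : ℕ) (hi : i ≠ n) : (K (n + 1)).1 i = (K n).1 i := Function.update_of_ne hi _ _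
  have hstable (i n : ℕ) (hin : i + 1 ≤ n) : (K n).1 i = (K (i + 1)).1 i := by
    induction n, hin using Nat.le_induction with
    | base => rfl
    | succ n hn ih => rw [hK n i (by omega), ih]
  refine ⟨fun i => (K (i + 1)).1 i, ?_⟩
  by_contra! hlt
  -- Outer regularity: an open `U` of measure below `c` would contain the image of a whole stage-`n`
  -- cylinder.
  obtain ⟨U, hU, hUo, hUc⟩ := Set.exists_isOpen_lt_of_lt _ _ hlt
  obtain ⟨n, hn⟩ := exists_cylinder_subset_of_box_subset (hUo.preimage hg) _
    (Set.image_subset_iff.1 hU)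
  refine ((K n).2.trans_le (measure_mono (Set.image_subset_iff.2 fun x hx => hn ?_))).not_gt hUc
  exact fun i hi => hstable i n hi ▸ hx i hi

/-- Analytic sets are universally measurable. -/
theorem MeasureTheory.AnalyticSet.nullMeasurableSet {Y : Type*} [TopologicalSpace Y] [T2Space Y]
    [MeasurableSpace Y] [OpensMeasurableSpace Y] {s : Set Y} (hs : AnalyticSet s)
    (μ : Measure Y) [IsFiniteMeasure μ] [μ.OuterRegular] : NullMeasurableSet s μ := by
  rw [AnalyticSet] at hs
  rcases hs with rfl | ⟨g, hg, rfl⟩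
  · exact MeasurableSet.empty.nullMeasurableSet
  have hmeas (k : ℕ → ℕ) : MeasurableSet (g '' {x | ∀ i, x i ≤ k i}) :=
    ((isCompact_setOf_forall_le k).image hg).measurableSet
  rcases eq_or_ne (μ (Set.range g)) 0 with h0 | h0
  · exact NullMeasurableSet.of_null h0
  obtain ⟨u, -, hu, hulim⟩ := exists_seq_strictMono_tendsto' (pos_iff_ne_zero.2 h0)
  choose k hk using fun n => exists_box_image_measure_ge μ hg (hu n).2
  have hT : MeasurableSet (⋃ n, g '' {x | ∀ i, x i ≤ k n i}) := .iUnion fun n => hmeas _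
  have hge : μ (Set.range g) ≤ μ (⋃ n, g '' {x | ∀ i, x i ≤ k n i}) :=
    le_of_tendsto' hulim fun n =>
      (hk n).trans (measure_mono (Set.subset_iUnion (fun n => g '' {x | ∀ i, x i ≤ k n i}) n))
  exact hT.nullMeasurableSet.congr (ae_eq_of_subset_of_measure_ge
    (Set.iUnion_subset fun n => Set.image_subset_range _ _) hge hT.nullMeasurableSet
    (measure_ne_top μ _))

/-- A measurable subset of a product is the pullback of a measurable subset of the product of
Cantor space with the second factor. -/
theorem MeasurableSet.exists_preimage_cantor_prod {Ω X : Type*} [MeasurableSpace Ω]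
    [MeasurableSpace X] {E : Set (Ω × X)} (hE : MeasurableSet E) :
    ∃ φ : Ω → ℕ → Bool, Measurable φ ∧ ∃ E' : Set ((ℕ → Bool) × X), MeasurableSet E' ∧
      E = Prod.map φ id ⁻¹' E' := by
  classical
  rw [← generateFrom_prod] at hE
  induction E, hE using MeasurableSpace.generateFrom_induction with
  | hC t ht _ =>
    obtain ⟨A, hA, B, hB, rfl⟩ := ht
    refine ⟨fun ω _ => decide (ω ∈ A), measurable_pi_lambda _ fun _ => ?_,
      {y | y 0 = true} ×ˢ B, ?_, ?_⟩
    · refine measurable_to_bool ?_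
      simpa [Set.preimage] using hA
    · exact (measurable_pi_apply (X := fun _ : ℕ => Bool) 0 (measurableSet_singleton true)).prod hB
    · ext ⟨ω, x⟩
      simp
  | empty => exact ⟨fun _ _ => true, measurable_const, ∅, .empty, rfl⟩
  | compl t _ ih =>
    obtain ⟨φ, hφ, E', hE', rfl⟩ := ih
    exact ⟨φ, hφ, E'ᶜ, hE'.compl, rfl⟩
  | iUnion t _ ih =>
    choose φ hφ E' hE' h using ih
    -- Pairing packs countably many codes into one; `π n` recovers the `n`-th.
    let π (n : ℕ) (y : ℕ → Bool) (m : ℕ) : Bool := y (Nat.pair n m)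
    have hπ (n : ℕ) : Measurable (π n) :=
      measurable_pi_lambda _ fun m => measurable_pi_apply _
    refine ⟨fun ω j => φ j.unpair.1 ω j.unpair.2,
      measurable_pi_lambda _ fun j => (measurable_pi_apply _).comp (hφ _),
      ⋃ n, Prod.map (π n) id ⁻¹' E' n,
      .iUnion fun n => ((hπ n).prodMap measurable_id) (hE' n), ?_⟩
    ext ⟨ω, x⟩
    simp [h, π]

/-- Measurable projection theorem: over a complete finite measure space, the projection of a
measurable subset of the product with a Polish space is measurable. -/
theorem MeasurableSet.image_fst_of_isComplete {Ω X : Type*} [MeasurableSpace Ω] (P : Measure Ω)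
    [IsFiniteMeasure P] [P.IsComplete] [TopologicalSpace X] [PolishSpace X] [MeasurableSpace X]
    [BorelSpace X] {E : Set (Ω × X)} (hE : MeasurableSet E) : MeasurableSet (Prod.fst '' E) := by
  obtain ⟨φ, hφ, E', hE', rfl⟩ := hE.exists_preimage_cantor_prod
  have himage : Prod.fst '' (Prod.map φ id ⁻¹' E') = φ ⁻¹' (Prod.fst '' E') := by
    ext ω
    simp
  have hnull := (hE'.analyticSet_image measurable_fst).nullMeasurableSet (P.map φ)
  rw [himage]
  exact (hnull.preimage (hφ.quasiMeasurePreserving P)).measurable_of_complete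

/-- A measurable closed-valued mapping has a measurable graph. -/
theorem MeasurableSetValued.measurableSet_graph {Ω X : Type*} [MeasurableSpace Ω]
    [TopologicalSpace X] [SecondCountableTopology X] [MeasurableSpace X] [OpensMeasurableSpace X]
    {C : Ω → Set X} (hC : MeasurableSetValued C) (hCcl : ∀ ω, IsClosed (C ω)) :
    MeasurableSet {p : Ω × X | p.2 ∈ C p.1} := by
  have hb := TopologicalSpace.isBasis_countableBasis X
  -- As `C ω` is closed, `x ∉ C ω` iff some basic open `B ∋ x` misses `C ω`.
  have hgraph : {p : Ω × X | p.2 ∈ C p.1} =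
      (⋃ B ∈ TopologicalSpace.countableBasis X, {ω | (C ω ∩ B).Nonempty}ᶜ ×ˢ B)ᶜ := by
    ext ⟨ω, x⟩
    rw [Set.mem_ofPred_eq, ← (hCcl ω).closure_eq, hb.mem_closure_iff]
    simp only [Set.mem_compl_iff, Set.mem_iUnion, Set.mem_prod, Set.mem_ofPred_eq, not_exists,
      not_and', not_not, Set.inter_comm]
  rw [hgraph]
  exact (MeasurableSet.biUnion (TopologicalSpace.countable_countableBasis X) fun B hB =>
    (hC B (hb.isOpen hB)).compl.prod (hb.isOpen hB).measurableSet).compl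

theorem mainTheorem1 {Ω X : Type*} [MeasurableSpace Ω] (P : Measure Ω) [IsProbabilityMeasure P]
    [P.IsComplete] [TopologicalSpace X] [PolishSpace X] [MeasurableSpace X] [BorelSpace X]
    (f : Ω × X → ℝ) (hf : Measurable f)
    (C : Ω → Set X) (hCne : ∀ ω, (C ω).Nonempty) (hCcl : ∀ ω, IsClosed (C ω))
    (hC : MeasurableSetValued C) :
    Measurable (optimalValue f C) ∧
      ∀ η : Ω → ℝ, (∀ ω, IsGLB ((fun x => f (ω, x)) '' C ω) (η ω)) → Measurable η := by
  have hgraph := hC.measurableSet_graph hCcl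
  constructor
  · refine measurable_of_Iio fun a => ?_
    have hE : MeasurableSet ({p : Ω × X | p.2 ∈ C p.1} ∩ {p | (f p : EReal) < a}) :=
      hgraph.inter (hf.coe_real_ereal measurableSet_Iio)
    convert hE.image_fst_of_isComplete P using 1
    ext ω
    simp [optimalValue, iInf_lt_iff]
  · intro η hη
    refine measurable_of_Iio fun a => ?_
    have hE : MeasurableSet ({p : Ω × X | p.2 ∈ C p.1} ∩ {p | f p < a}) :=
      hgraph.inter (hf measurableSet_Iio)
    convert hE.image_fst_of_isComplete P using 1
    ext ω
    simp [isGLB_lt_iff (hη ω)]
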